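/- **Setting.** Let $(\mathsf{SecretGen},\mathsf{Insert},\mathsf{Detect})$ be a PPT symmetric watermarking scheme, $(\mathsf{Share},\mathsf{Reconst})$ a PPT two-party secret sharing scheme for watermarking secrets in which both shares are needed for reconstruction, and let $\mathsf{IDGen}(D)=H_{hk}(\text{owner}\,\|\,\text{metadata of }D\,\|\,\text{date})$ for a keyed hash family $H$ with public key $hk$. Puppy-TEE runs between an Owner $\mathcal O$, a Holder $\mathcal H$ and a Prover $\mathcal P$ whose machine contains a trusted execution environment (TEE). *Ownership generation.* On input an asset $D_o$, $\mathcal O$ computes $sec\leftarrow\mathsf{SecretGen}(1^\lambda)$, $D_w\leftarrow\mathsf{Insert}(D_o,sec)$, $id=\mathsf{IDGen}(D_w)$ and $(tk_{\mathcal H},tk_{\mathcal P})\leftarrow\mathsf{Share}(sec)$, and sends $(id,D_w,tk_{\mathcal H})$ to $\mathcal H$ and $(id,tk_{\mathcal P})$ to $\mathcal P$ over secure channels. *Verification.* $\mathcal H$ remotely attests the enclave on $\mathcal P$ and aborts if this fails; otherwise $\mathcal H$ and the enclave obtain keys of a secure channel, whose ciphertexts travel through $\mathcal P$. Over this channel $\mathcal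 H$ sends $(id,D_w,tk_{\mathcal H})$; the enclave fetches the token stored for $id$ in $\mathcal P$'s database, runs $\mathsf{Reconst}$ on the two tokens and $\mathsf{Detect}$ on $D_w$ and the reconstructed secret, and sends the bit $res$ back over the channel. $\mathcal H$ outputs Valid if $res=1$, Invalid if $res=0$, and abort if it gets no authentic answer. *Ideal functionality.* $\mathcal F$ receives $D_o$ from $\mathcal O$, generates $sec,D_w,id,tk_{\mathcal H},tk_{\mathcal P}$ as above, and sends $(id,D_w,sec)$ to $\mathcal O$, $(id,D_w,tk_{\mathcal H})$ to $\mathcal H$ and $(id,tk_{\mathcal P})$ to $\mathcal P$. For verification it receives $(id,tk_{\mathcal H},D_w)$ from $\mathcal H$ and a database of pairs (identifier, token) from $\mathcal P$; it sends abort to $\mathcal H$ if $id\ne\mathsf{IDGen}(D_w)$ or $id$ is not in the database, and otherwise runs watermark detection on $D_w$ with the secret reconstructed from $tk_{\mathcal H}$ and the token stored for $id$, and sends the result to $\mathcal H$. $\mathcal P$ receives nothing in this phase. **Theorem.** Assume that - the secret sharing scheme is secure: the two shares determine the secret, and a single share reveals nothing about it (the shares of any two secrets are computationally indistinguishable); -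 the watermarking scheme is secure: honestly inserted watermarks are always detected, no non-uniform PPT adversary can guess $sec$ from $D_w$ with non-negligible probability, and none can, with non-negligible probability, turn $D_w$ into a similar asset in which the watermark is no longer detected; - the TEE is secure: $\mathcal P$ sees and influences an enclave's execution only through its input/output interface; attestation succeeds only towards the genuine enclave running the prescribed program, and gives $\mathcal H$ and the enclave fresh channel keys unknown to $\mathcal P$; and for each direction of the channel a non-uniform PPT attacker cannot distinguish the encryption from an ideal channel on which the ciphertext is independent of the message and only the unmodified ciphertext is accepted; - the hash family is collision-resistant. Then Puppy-TEE is secure against every static malicious non-uniform PPT adversary corrupting $\mathcal P$: for every such adversary $\mathcal A$ in the real world there is a non-uniform PPT simulator $\mathcal S$ in the role of $\mathcal P$ in the ideal world such that, for all auxiliary inputs $aux\in\{0,1\}^*$ of polynomial length and all assets $D_o$, the joint distribution of $hk$, the outputs $(id,D_w,sec)$ of $\mathcal O$, the outputs of $\mathcal H$ ($(id,D_w,tk_{\mathcal H})$ and the verdict) and the output of the adversary in the ideal execution with $\mathcal S(aux)$ is computationally indistinguishable, in the security parameter $\lambda$, from the same joint distribution in the real execution with $\mathcal A(aux)$. -/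

import Mathlib

open Filter

namespace Puppy

/-! Bit strings, probabilistic circuits and non-uniform probabilistic polynomial time -/

/-- Bit strings whose positions ("wires") are the elements of `α`; concatenation of `x` and `y`
is `Sum.elim x y`. -/
abbrev Bits (α : Type) : Type := α → Bool

/-- Probabilistic Boolean circuits with input wires `α` and output wires `β`: rewiring (copying,
permuting, dropping wires), constants, fair coins, NAND gates, multiplexers, sequential and
parallel composition. -/
inductive Circuit : Type → Type → Type 1
  | wire {α β : Type} [Fintype β] (σ : β → α) : Circuit α β
  | const (b : Bool) : Circuit Empty Unit
  | coin : Circuit Empty Unit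
  | nand : Circuit (Unit ⊕ Unit) Unit
  | mux {α β : Type} (t e : Circuit α β) : Circuit (Unit ⊕ α) β
  | comp {α β γ : Type} (f : Circuit α β) (g : Circuit β γ) : Circuit α γ
  | par {α β α' β' : Type} (f : Circuit α β) (g : Circuit α' β') : Circuit (α ⊕ α') (β ⊕ β')

namespace Circuit

/-- The size of a circuit. Every output wire is paid for, so the size bounds the number of output
wires, of gates and of coins. -/
def size : {α β : Type} → Circuit α β → ℕ
  | _, _, @wire _ β _ _ => Fintype.card β
  | _, _, const _ => 1
  | _, _, coin => 1
  | _, _, nand => 1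
  | _, _, mux t e => t.size + e.size + 1
  | _, _, comp f g => f.size + g.size
  | _, _, par f g => f.size + g.size

/-- The output distribution of a circuit on a given input. -/
noncomputable def eval : {α β : Type} → Circuit α β → Bits α → PMF (Bits β)
  | _, _, wire σ, x => PMF.pure (x ∘ σ)
  | _, _, const b, _ => PMF.pure fun _ => b
  | _, _, coin, _ => (PMF.uniformOfFintype Bool).map fun b _ => b
  | _, _, nand, x => PMF.pure fun _ => !(x (.inl ()) && x (.inr ()))
  | _, _, mux t e, x => if x (.inl ()) then t.eval (x ∘ .inr) else e.eval (x ∘ .inr)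
  | _, _, comp f g, x => (f.eval x).bind g.eval
  | _, _, par f g, x =>
      (f.eval (x ∘ .inl)).bind fun y => (g.eval (x ∘ .inr)).map fun z => Sum.elim y z

end Circuit

/-- `f` is bounded by a polynomial in the security parameter. -/
def PolyBounded (f : ℕ → ℕ) : Prop := ∃ p : Polynomial ℕ, ∀ n, f n ≤ p.eval n

/-- Negligible functions of the security parameter. -/
def Negligible (f : ℕ → ℝ) : Prop :=
  Asymptotics.SuperpolynomialDecay atTop (fun n : ℕ => (n : ℝ)) f

/-- A non-uniform PPT algorithm, given by one circuit for each security parameter. -/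
def IsPPT {α β : ℕ → Type} (C : ∀ n, Circuit (α n) (β n)) : Prop :=
  PolyBounded fun n => (C n).size

/-- The probability of an event. -/
noncomputable def prob {Ω : Type} (p : PMF Ω) (E : Set Ω) : ℝ := (p.toOuterMeasure E).toReal

/-- The probability that a one-bit output is `1`. -/
noncomputable def prOne (p : PMF (Bits Unit)) : ℝ := prob p {y | y () = true}

/-- Computational indistinguishability of two ensembles against non-uniform PPT
distinguishers. -/
def CompIndist {W : ℕ → Type} (X Y : ∀ n, PMF (Bits (W n))) : Prop :=
  ∀ D : ∀ n, Circuit (W n) Unit, IsPPT D →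
    Negligible fun n => |prOne ((X n).bind (D n).eval) - prOne ((Y n).bind (D n).eval)|

/-- Reads a string whose first bit says whether the rest is present. -/
def toOption {α : Type} (x : Bits (Unit ⊕ α)) : Option (Bits α) :=
  if x (.inl ()) then some (x ∘ .inr) else none

/-- The string that encodes an optional string. -/
def ofOption {α : Type} : Option (Bits α) → Bits (Unit ⊕ α)
  | none => fun _ => false
  | some y => Sum.elim (fun _ => true) y

/-! Watermarking -/

/-- A symmetric watermarking scheme. `assetLen n` is the length of (the encoding of) an asset and
`secLen n` that of a watermarking secret; `Similar` is the perceptual similarity of assets. -/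
structure WatermarkScheme where
  assetLen : ℕ → ℕ
  secLen : ℕ → ℕ
  Similar : ∀ n, Bits (Fin (assetLen n)) → Bits (Fin (assetLen n)) → Prop
  secretGen : ∀ n, Circuit Empty (Fin (secLen n))
  insert : ∀ n, Circuit (Fin (assetLen n) ⊕ Fin (secLen n)) (Fin (assetLen n))
  /-- input `(D_w, sec)`, output `1` for acceptance -/
  detect : ∀ n, Circuit (Fin (assetLen n) ⊕ Fin (secLen n)) Unit
  secretGen_ppt : IsPPT secretGen
  insert_ppt : IsPPT insert
  detect_ppt : IsPPT detect

namespace WatermarkScheme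
variable (wm : WatermarkScheme)

/-- The pair `(D_w, sec)` produced by an honest owner of the asset `Do`. -/
noncomputable def watermark (n : ℕ) (Do : Bits (Fin (wm.assetLen n))) :
    PMF (Bits (Fin (wm.assetLen n)) × Bits (Fin (wm.secLen n))) :=
  ((wm.secretGen n).eval Empty.elim).bind fun sec =>
    ((wm.insert n).eval (Sum.elim Do sec)).map fun Dw => (Dw, sec)

/-- An honestly inserted watermark is detected with probability one. -/
def Correct : Prop := ∀ n (Do : Bits (Fin (wm.assetLen n))),
  prOne ((wm.watermark n Do).bind fun x => (wm.detect n).eval (Sum.elim x.1 x.2)) = 1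

/-- Security against guessing: the watermarked asset does not expose the secret. -/
def GuessSecure : Prop :=
  ∀ G : ∀ n, Circuit (Fin (wm.assetLen n)) (Fin (wm.secLen n)), IsPPT G →
    ∀ Do : ∀ n, Bits (Fin (wm.assetLen n)), Negligible fun n =>
      prob ((wm.watermark n (Do n)).bind fun x => ((G n).eval x.1).map fun sec' => (x, sec'))
        {y | y.2 = y.1.2}

/-- Robustness (unremovability): no adversary can turn a watermarked asset into a similar one in
which the watermark is no longer detected. -/
def Unremovable : Prop :=
  ∀ R : ∀ n, Circuit (Fin (wm.assetLen n)) (Fin (wm.assetLen n)), IsPPT R →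
    ∀ Do : ∀ n, Bits (Fin (wm.assetLen n)), Negligible fun n =>
      prob ((wm.watermark n (Do n)).bind fun x => ((R n).eval x.1).bind fun D' =>
          ((wm.detect n).eval (Sum.elim D' x.2)).map fun b => (x.1, D', b ()))
        {y | wm.Similar n y.2.1 y.1 ∧ y.2.2 = false}

def Secure : Prop := wm.Correct ∧ wm.GuessSecure ∧ wm.Unremovable

end WatermarkScheme

/-! Secret sharing -/

/-- A two-party secret sharing scheme (parties: holder and prover; both shares are needed) for
secrets of length `secLen n`. -/
structure SecretSharing (secLen : ℕ → ℕ) where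
  hLen : ℕ → ℕ
  pLen : ℕ → ℕ
  share : ∀ n, Circuit (Fin (secLen n)) (Fin (hLen n) ⊕ Fin (pLen n))
  reconst : ∀ n, Circuit (Fin (hLen n) ⊕ Fin (pLen n)) (Fin (secLen n))
  share_ppt : IsPPT share
  reconst_ppt : IsPPT reconst

namespace SecretSharing
variable {secLen : ℕ → ℕ} (ss : SecretSharing secLen)

/-- The two shares together determine the secret. -/
def Correct : Prop := ∀ n (s : Bits (Fin (secLen n))),
  ((ss.share n).eval s).bind (ss.reconst n).eval = PMF.pure s

/-- A single share reveals nothing about the secret. -/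
def Private : Prop := ∀ s s' : ∀ n, Bits (Fin (secLen n)),
  CompIndist (fun n => ((ss.share n).eval (s n)).map fun x => x ∘ Sum.inl)
      (fun n => ((ss.share n).eval (s' n)).map fun x => x ∘ Sum.inl) ∧
    CompIndist (fun n => ((ss.share n).eval (s n)).map fun x => x ∘ Sum.inr)
      (fun n => ((ss.share n).eval (s' n)).map fun x => x ∘ Sum.inr)

def Secure : Prop := ss.Correct ∧ ss.Private

end SecretSharing

/-! Hash functions and identifiers -/

/-- A keyed family of hash functions on strings with positions `In n`; `fn` is the function that
the circuit `hash` computes. -/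
structure HashFamily (In : ℕ → Type) where
  keyLen : ℕ → ℕ
  outLen : ℕ → ℕ
  keyGen : ∀ n, Circuit Empty (Fin (keyLen n))
  fn : ∀ n, Bits (Fin (keyLen n)) → Bits (In n) → Bits (Fin (outLen n))
  hash : ∀ n, Circuit (Fin (keyLen n) ⊕ In n) (Fin (outLen n))
  hash_eval : ∀ n hk x, (hash n).eval (Sum.elim hk x) = PMF.pure (fn n hk x)
  keyGen_ppt : IsPPT keyGen
  hash_ppt : IsPPT hash

/-- Collision resistance against non-uniform PPT adversaries. -/
def HashFamily.CollisionResistant {In : ℕ → Type} (H : HashFamily In) : Prop :=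
  ∀ C : ∀ n, Circuit (Fin (H.keyLen n)) (In n ⊕ In n), IsPPT C → Negligible fun n =>
    prob (((H.keyGen n).eval Empty.elim).bind fun hk => ((C n).eval hk).map fun x => (hk, x))
      {y | y.2 ∘ Sum.inl ≠ y.2 ∘ Sum.inr ∧
        H.fn n y.1 (y.2 ∘ Sum.inl) = H.fn n y.1 (y.2 ∘ Sum.inr)}

/-- The generation of identifiers: `IDGen(D_w)` is the hash of the owner's name, the metadata
of `D_w` and the date. -/
structure IdScheme (assetLen : ℕ → ℕ) where
  ownerLen : ℕ → ℕ
  metaLen : ℕ → ℕ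
  dateLen : ℕ → ℕ
  owner : ∀ n, Bits (Fin (ownerLen n))
  date : ∀ n, Bits (Fin (dateLen n))
  metadata : ∀ n, Bits (Fin (assetLen n)) → Bits (Fin (metaLen n))
  metadataCircuit : ∀ n, Circuit (Fin (assetLen n)) (Fin (metaLen n))
  metadata_eval : ∀ n D, (metadataCircuit n).eval D = PMF.pure (metadata n D)
  hash : HashFamily fun n => Fin (ownerLen n) ⊕ (Fin (metaLen n) ⊕ Fin (dateLen n))
  metadata_ppt : IsPPT metadataCircuit
  ownerLen_poly : PolyBounded ownerLen
  dateLen_poly : PolyBounded dateLen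

/-- `IDGen(D)` under the public hash key `hk`. -/
def IdScheme.idGen {assetLen : ℕ → ℕ} (I : IdScheme assetLen) (n : ℕ)
    (hk : Bits (Fin (I.hash.keyLen n))) (D : Bits (Fin (assetLen n))) :
    Bits (Fin (I.hash.outLen n)) :=
  I.hash.fn n hk (Sum.elim (I.owner n) (Sum.elim (I.metadata n D) (I.date n)))

/-! The trusted execution environment -/

/-- The encryption that protects one direction of the channel between a remote party and an
attested enclave, for messages with positions `M n`. Decryption outputs an optional message. -/
structure Channel (M : ℕ → Type) where
  keyLen : ℕ → ℕ
  ctLen : ℕ → ℕ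
  gen : ∀ n, Circuit Empty (Fin (keyLen n))
  enc : ∀ n, Circuit (Fin (keyLen n) ⊕ M n) (Fin (ctLen n))
  dec : ∀ n, Circuit (Fin (keyLen n) ⊕ Fin (ctLen n)) (Unit ⊕ M n)
  gen_ppt : IsPPT gen
  enc_ppt : IsPPT enc
  dec_ppt : IsPPT dec

namespace Channel
variable {M : ℕ → Type} (ch : Channel M)

noncomputable def newKey (n : ℕ) : PMF (Bits (Fin (ch.keyLen n))) := (ch.gen n).eval Empty.elim

noncomputable def encrypt (n : ℕ) (k : Bits (Fin (ch.keyLen n))) (m : Bits (M n)) :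
    PMF (Bits (Fin (ch.ctLen n))) := (ch.enc n).eval (Sum.elim k m)

noncomputable def decrypt (n : ℕ) (k : Bits (Fin (ch.keyLen n))) (c : Bits (Fin (ch.ctLen n))) :
    PMF (Option (Bits (M n))) := ((ch.dec n).eval (Sum.elim k c)).map toOption

/-- An attacker on the channel: it chooses the message, sees the ciphertext, decides which
ciphertext is delivered, and sees what the receiver decrypts. -/
structure Attacker (ch : Channel M) where
  St : ℕ → Type
  [finSt : ∀ n, Fintype (St n)]
  choose : ∀ n, Circuit Empty (St n ⊕ M n)
  tamper : ∀ n, Circuit (St n ⊕ Fin (ch.ctLen n)) (St n ⊕ Fin (ch.ctLen n))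
  guess : ∀ n, Circuit (St n ⊕ (Unit ⊕ M n)) Unit
  choose_ppt : IsPPT choose
  tamper_ppt : IsPPT tamper
  guess_ppt : IsPPT guess

/-- The attack on the actual encryption. -/
noncomputable def realGame (B : ch.Attacker) (n : ℕ) : PMF (Bits Unit) := do
  let x ← (B.choose n).eval Empty.elim
  let k ← ch.newKey n
  let c ← ch.encrypt n k (x ∘ .inr)
  let y ← (B.tamper n).eval (Sum.elim (x ∘ .inl) c)
  let m ← ch.decrypt n k (y ∘ .inr)
  (B.guess n).eval (Sum.elim (y ∘ .inl) (ofOption m))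

/-- The attack on an ideal channel: the ciphertext is independent of the message, and only
faithful delivery of the ciphertext lets the receiver obtain a message, namely the one sent. -/
noncomputable def idealGame (B : ch.Attacker) (n : ℕ) : PMF (Bits Unit) := do
  let x ← (B.choose n).eval Empty.elim
  let k ← ch.newKey n
  let c ← ch.encrypt n k (fun _ => false)
  let y ← (B.tamper n).eval (Sum.elim (x ∘ .inl) c)
  let m : Option (Bits (M n)) := if y ∘ Sum.inr = c then some (x ∘ .inr) else none
  (B.guess n).eval (Sum.elim (y ∘ .inl) (ofOption m))

/-- Confidentiality and authenticity of the channel. -/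
def Secure : Prop := ∀ B : ch.Attacker,
  Negligible fun n => |prOne (ch.realGame B n) - prOne (ch.idealGame B n)|

end Channel

/-- A trusted execution environment on the prover's machine, as the trusted third party that
remote attestation provides: attestation succeeds only towards the genuine enclave running the
agreed program, and then gives the remote party and the enclave (and nobody else) fresh keys for
the two directions of a channel, whose ciphertexts travel through the untrusted host. -/
structure TEE (Req Resp : ℕ → Type) where
  up : Channel Req
  down : Channel Resp

def TEE.Secure {Req Resp : ℕ → Type} (T : TEE Req Resp) : Prop := T.up.Secure ∧ T.down.Secure

/-! The protocol -/

/-- The components of an instance of the protocol. A request to the enclave is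
`(id, D_w, tk_H)`, its response is the bit `res`. -/
structure Instance where
  wm : WatermarkScheme
  ss : SecretSharing wm.secLen
  ids : IdScheme wm.assetLen
  tee : TEE (fun n => Fin (ids.hash.outLen n) ⊕ (Fin (wm.assetLen n) ⊕ Fin (ss.hLen n)))
    (fun _ => Unit)

/-- What the holder outputs. -/
inductive Verdict
  | valid
  | invalid
  | abort

def Verdict.ofRes (res : Bool) : Verdict := if res then .valid else .invalid

def Verdict.bits : Verdict → Bits (Fin 2)
  | .valid => ![true, true]
  | .invalid => ![false, true]
  | .abort => ![false, false]

namespace Instance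
variable (I : Instance)

abbrev Asset (n : ℕ) : Type := Fin (I.wm.assetLen n)
abbrev Sec (n : ℕ) : Type := Fin (I.wm.secLen n)
abbrev HashKey (n : ℕ) : Type := Fin (I.ids.hash.keyLen n)
abbrev Id (n : ℕ) : Type := Fin (I.ids.hash.outLen n)
/-- the holder's (authorization) token `tk_H` -/
abbrev TokenH (n : ℕ) : Type := Fin (I.ss.hLen n)
/-- the prover's (assignment) token `tk_P` -/
abbrev TokenP (n : ℕ) : Type := Fin (I.ss.pLen n)
abbrev CtUp (n : ℕ) : Type := Fin (I.tee.up.ctLen n)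
abbrev CtDown (n : ℕ) : Type := Fin (I.tee.down.ctLen n)

/-- What ownership generation produces; `hk` is the public key of the hash function. -/
structure Ownership (n : ℕ) where
  hk : Bits (I.HashKey n)
  sec : Bits (I.Sec n)
  Dw : Bits (I.Asset n)
  id : Bits (I.Id n)
  tkH : Bits (I.TokenH n)
  tkP : Bits (I.TokenP n)

/-- Ownership generation for the asset `Do`. -/
noncomputable def generate (n : ℕ) (Do : Bits (I.Asset n)) : PMF (I.Ownership n) := do
  let hk ← (I.ids.hash.keyGen n).eval Empty.elim
  let sec ← (I.wm.secretGen n).eval Empty.elim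
  let Dw ← (I.wm.insert n).eval (Sum.elim Do sec)
  let tk ← (I.ss.share n).eval sec
  return ⟨hk, sec, Dw, I.ids.idGen n hk Dw, tk ∘ Sum.inl, tk ∘ Sum.inr⟩

/-- Reconstruction of the watermarking secret from the two tokens, followed by detection. -/
noncomputable def detectWithTokens (n : ℕ) (Dw : Bits (I.Asset n)) (tkH : Bits (I.TokenH n))
    (tkP : Bits (I.TokenP n)) : PMF Bool := do
  let sec ← (I.ss.reconst n).eval (Sum.elim tkH tkP)
  let res ← (I.wm.detect n).eval (Sum.elim Dw sec)
  return res ()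

/-- Everything that is compared between the two worlds: the public hash key, the outputs
`(id, D_w, sec)` of the owner and `(id, D_w, tk_H)`, `verdict` of the holder, and the output of the
adversary. -/
abbrev Joint (outLen : ℕ → ℕ) (n : ℕ) : Type :=
  I.HashKey n ⊕ (I.Id n ⊕ (I.Asset n ⊕ (I.Sec n ⊕ (I.TokenH n ⊕ (Fin 2 ⊕ Fin (outLen n))))))

def joint {I : Instance} {outLen : ℕ → ℕ} {n : ℕ} (g : I.Ownership n) (v : Verdict)
    (out : Bits (Fin (outLen n))) : Bits (I.Joint outLen n) :=
  Sum.elim g.hk (Sum.elim g.id (Sum.elim g.Dw (Sum.elim g.sec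
    (Sum.elim g.tkH (Sum.elim v.bits out)))))

/-! The real world -/

/-- A malicious prover with auxiliary input of length `auxLen n` and output of length
`outLen n`. It controls its host, its database and the network between the holder and its
enclave, but not the inside of the enclave. -/
structure MaliciousProver (auxLen outLen : ℕ → ℕ) where
  St : ℕ → Type
  [finSt : ∀ n, Fintype (St n)]
  /-- on `aux`, the hash key and the owner's message `(id, tk_P)`; the output bit says whether it
  lets the holder's remote attestation take place with the genuine enclave -/
  start : ∀ n, Circuit
    (Fin (auxLen n) ⊕ (I.HashKey n ⊕ (I.Id n ⊕ I.TokenP n))) (St n ⊕ Unit)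
  /-- on the holder's ciphertext; outputs the ciphertext to be delivered to the enclave, if any -/
  onRequest : ∀ n, Circuit (St n ⊕ I.CtUp n) (St n ⊕ (Unit ⊕ I.CtUp n))
  /-- on the enclave's query for the database entry of an identifier; outputs the entry, if any -/
  onFetch : ∀ n, Circuit (St n ⊕ I.Id n) (St n ⊕ (Unit ⊕ I.TokenP n))
  /-- on the enclave's ciphertext; outputs the ciphertext to be delivered to the holder, if any -/
  onResponse : ∀ n, Circuit (St n ⊕ I.CtDown n) (St n ⊕ (Unit ⊕ I.CtDown n))
  /-- at the end of the execution -/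
  finish : ∀ n, Circuit (St n) (Fin (outLen n))
  start_ppt : IsPPT start
  onRequest_ppt : IsPPT onRequest
  onFetch_ppt : IsPPT onFetch
  onResponse_ppt : IsPPT onResponse
  finish_ppt : IsPPT finish

section
variable {I} {auxLen outLen : ℕ → ℕ} (A : I.MaliciousProver auxLen outLen) (n : ℕ)

/-- The last part of verification: the enclave sends `res` to the holder. The result is the
holder's verdict and the adversary's state. -/
noncomputable def realRespond (st : Bits (A.St n)) (kDown : Bits (Fin (I.tee.down.keyLen n)))
    (res : Bool) : PMF (Verdict × Bits (A.St n)) := do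
  let c ← I.tee.down.encrypt n kDown (fun _ => res)
  let x ← (A.onResponse n).eval (Sum.elim st c)
  match toOption (x ∘ .inr) with
  | none => return (.abort, x ∘ .inl)
  | some c' =>
    match ← I.tee.down.decrypt n kDown c' with
    | none => return (.abort, x ∘ .inl)
    | some r => return (.ofRes (r ()), x ∘ .inl)

/-- The enclave's program on a request `(id, D_w, tk_H)`: it fetches `tk_P` from the database of
its host, reconstructs the secret, runs detection and responds. -/
noncomputable def realEnclave (st : Bits (A.St n)) (kDown : Bits (Fin (I.tee.down.keyLen n)))
    (req : Bits (I.Id n ⊕ (I.Asset n ⊕ I.TokenH n))) : PMF (Verdict × Bits (A.St n)) := do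
  let x ← (A.onFetch n).eval (Sum.elim st (req ∘ .inl))
  match toOption (x ∘ .inr) with
  | none => return (.abort, x ∘ .inl)
  | some tkP =>
    let res ← I.detectWithTokens n (req ∘ .inr ∘ .inl) (req ∘ .inr ∘ .inr) tkP
    realRespond A n (x ∘ .inl) kDown res

/-- Verification by an honest holder with `(id, D_w, tk_H)`, once attestation has succeeded. -/
noncomputable def realVerify (st : Bits (A.St n)) (id : Bits (I.Id n)) (Dw : Bits (I.Asset n))
    (tkH : Bits (I.TokenH n)) : PMF (Verdict × Bits (A.St n)) := do
  let kUp ← I.tee.up.newKey n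
  let kDown ← I.tee.down.newKey n
  let c ← I.tee.up.encrypt n kUp (Sum.elim id (Sum.elim Dw tkH))
  let x ← (A.onRequest n).eval (Sum.elim st c)
  match toOption (x ∘ .inr) with
  | none => return (.abort, x ∘ .inl)
  | some c' =>
    match ← I.tee.up.decrypt n kUp c' with
    | none => return (.abort, x ∘ .inl)
    | some req => realEnclave A n (x ∘ .inl) kDown req

/-- The joint output of a real execution with owner's input `Do` and auxiliary input `aux`. -/
noncomputable def real (aux : Bits (Fin (auxLen n))) (Do : Bits (I.Asset n)) :
    PMF (Bits (I.Joint outLen n)) := do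
  let g ← I.generate n Do
  let x ← (A.start n).eval (Sum.elim aux (Sum.elim g.hk (Sum.elim g.id g.tkP)))
  let v ← if x (.inr ()) then realVerify A n (x ∘ .inl) g.id g.Dw g.tkH
    else PMF.pure (.abort, x ∘ .inl)
  let out ← (A.finish n).eval v.2
  return joint g v.1 out

end

/-! The ideal world -/

/-- A database of `k` slots, each of which may hold an entry `(id, tk_P)`. -/
abbrev Database (k n : ℕ) : Type := Fin k × (Unit ⊕ (I.Id n ⊕ I.TokenP n))

/-- The token stored for `id`: that of the first slot that holds an entry for `id`. -/
def lookup {I : Instance} {k n : ℕ} (db : Bits (I.Database k n)) (id : Bits (I.Id n)) :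
    Option (Bits (I.TokenP n)) :=
  (List.finRange k).findSome? fun i =>
    match toOption fun j => db (i, j) with
    | none => none
    | some e => if e ∘ Sum.inl = id then some (e ∘ Sum.inr) else none

/-- An ideal-world adversary in the place of the prover. It gets `aux`, the hash key and
`(id, tk_P)` from the functionality, and outputs the database that it sends to the functionality
together with its own output; the functionality sends it nothing else. -/
structure Simulator (auxLen outLen : ℕ → ℕ) where
  dbSize : ℕ → ℕ
  run : ∀ n, Circuit (Fin (auxLen n) ⊕ (I.HashKey n ⊕ (I.Id n ⊕ I.TokenP n)))
    (I.Database (dbSize n) n ⊕ Fin (outLen n))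
  run_ppt : IsPPT run

/-- The verification phase of the ideal functionality, on `(id, tk_H, D_w)` from the holder and
the database from the prover. -/
noncomputable def idealVerify {k n : ℕ} (hk : Bits (I.HashKey n)) (id : Bits (I.Id n))
    (tkH : Bits (I.TokenH n)) (Dw : Bits (I.Asset n)) (db : Bits (I.Database k n)) :
    PMF Verdict :=
  if id ≠ I.ids.idGen n hk Dw then PMF.pure .abort
  else match lookup db id with
    | none => PMF.pure .abort
    | some tkP => (I.detectWithTokens n Dw tkH tkP).map Verdict.ofRes

/-- The joint output of an ideal execution with owner's input `Do` and auxiliary input `aux`. -/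
noncomputable def ideal {I : Instance} {auxLen outLen : ℕ → ℕ} (S : I.Simulator auxLen outLen)
    (n : ℕ) (aux : Bits (Fin (auxLen n))) (Do : Bits (I.Asset n)) :
    PMF (Bits (I.Joint outLen n)) := do
  let g ← I.generate n Do
  let x ← (S.run n).eval (Sum.elim aux (Sum.elim g.hk (Sum.elim g.id g.tkP)))
  let v ← I.idealVerify g.hk g.id g.tkH g.Dw (x ∘ .inl)
  return joint g v (x ∘ .inr)

/-- Simulation security against a malicious prover. -/
def SecureAgainstProver : Prop :=
  ∀ auxLen outLen : ℕ → ℕ, PolyBounded auxLen →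
    ∀ A : I.MaliciousProver auxLen outLen, ∃ S : I.Simulator auxLen outLen,
      ∀ (aux : ∀ n, Bits (Fin (auxLen n))) (Do : ∀ n, Bits (I.Asset n)),
        CompIndist (fun n => ideal S n (aux n) (Do n)) (fun n => real A n (aux n) (Do n))

end Instance

end Puppy

namespace Puppy

/-! Polynomial bounds and negligible functions -/

/-! Over ideal channels the prover's view does not depend on the detection bit, so it can be
simulated without it. The simulator runs the prover on encryptions of the zero string under keys
that it draws itself, asks it for the token of `id`, and checks that both ciphertexts are delivered
unchanged. If everything succeeds, the token fills a one-slot database and the functionality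
computes the verdict; otherwise the slot is marked empty and the functionality sends abort.

Two game hops connect this to the real execution. By `real_bind`, a real execution followed by a
distinguisher is the real experiment on the holder's channel, for an attacker that plays all
parties. In the ideal experiment on that channel the enclave gets the holder's own request or
nothing; `idealExperiment_up` recognises this as the real experiment on the enclave's channel, for
an attacker that simulates the first channel internally. In the ideal experiment on the second
channel the ciphertext is independent of the result, so reconstruction and detection can be
postponed past all steps of the prover; by `ideal_bind` this is the ideal world. These three
statements are exact equalities of distributions; only replacing each channel by its ideal version
costs a negligible amount.

The attackers must be circuits of polynomial size; the closure properties of `Efficient` and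
`Feasible` give this. A flag wire in the state says whether verification goes on. It keeps the
experiments in a fixed shape: once it is cleared, the remaining steps run idly and the verdict is
abort. -/

theorem PolyBounded.mono {f g : ℕ → ℕ} (hg : PolyBounded g) (h : ∀ n, f n ≤ g n) :
    PolyBounded f := by
  obtain ⟨p, hp⟩ := hg
  exact ⟨p, fun n => (h n).trans (hp n)⟩

theorem PolyBounded.const (c : ℕ) : PolyBounded fun _ => c :=
  ⟨Polynomial.C c, fun n => by simp⟩

theorem PolyBounded.add {f g : ℕ → ℕ} (hf : PolyBounded f) (hg : PolyBounded g) :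
    PolyBounded fun n => f n + g n := by
  obtain ⟨p, hp⟩ := hf
  obtain ⟨q, hq⟩ := hg
  exact ⟨p + q, fun n => by simpa using add_le_add (hp n) (hq n)⟩

theorem PolyBounded.mul {f g : ℕ → ℕ} (hf : PolyBounded f) (hg : PolyBounded g) :
    PolyBounded fun n => f n * g n := by
  obtain ⟨p, hp⟩ := hf
  obtain ⟨q, hq⟩ := hg
  exact ⟨p * q, fun n => by simpa using Nat.mul_le_mul (hp n) (hq n)⟩

/-- The triangle inequality for a hybrid `b` between the real world `a` and the ideal world `c`; the
order in the conclusion is that of `CompIndist`. -/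
theorem Negligible.of_abs_sub {a b c : ℕ → ℝ} (hab : Negligible fun n => |a n - b n|)
    (hbc : Negligible fun n => |b n - c n|) : Negligible fun n => |c n - a n| := by
  refine Asymptotics.SuperpolynomialDecay.trans_abs_le
    (Asymptotics.SuperpolynomialDecay.add hab hbc) fun n => ?_
  simp only [Pi.add_apply, abs_abs]
  rw [abs_sub_comm, abs_of_nonneg (by positivity : 0 ≤ |a n - b n| + |b n - c n|)]
  exact abs_sub_le _ _ _

/-! Wires -/

/-- Families of finite wire types of polynomial cardinality. -/
class PolyWires (α : ℕ → Type) : Prop where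
  finite : ∀ n, Finite (α n)
  poly : PolyBounded fun n => Nat.card (α n)

/-- Every output wire is charged to the size. Hence the lengths of secrets, tokens, keys and
ciphertexts need no polynomial bound of their own: each is the output length of some PPT algorithm.
-/
theorem Circuit.finite_and_card_le_size {α β : Type} (C : Circuit α β) :
    Finite β ∧ Nat.card β ≤ C.size := by
  induction C with
  | wire σ => exact ⟨inferInstance, by simp [size]⟩
  | const b => exact ⟨inferInstance, by simp [size]⟩
  | coin => exact ⟨inferInstance, by simp [size]⟩
  | nand => exact ⟨inferInstance, by simp [size]⟩
  | mux t e ht he => exact ⟨ht.1, by simp only [size]; omega⟩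
  | comp f g hf hg => exact ⟨hg.1, by simp only [size]; omega⟩
  | par f g hf hg =>
    have := hf.1
    have := hg.1
    exact ⟨inferInstance, by simp only [size, Nat.card_sum]; omega⟩

theorem IsPPT.polyWires {α β : ℕ → Type} {C : ∀ n, Circuit (α n) (β n)} (hC : IsPPT C) :
    PolyWires β :=
  ⟨fun n => (C n).finite_and_card_le_size.1,
    PolyBounded.mono hC fun n => (C n).finite_and_card_le_size.2⟩

theorem PolyWires.of_injective {α β : ℕ → Type} (hβ : PolyWires β) (f : ∀ n, α n → β n)
    (hf : ∀ n, Function.Injective (f n)) : PolyWires α := by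
  have := hβ.finite
  exact ⟨fun n => Finite.of_injective _ (hf n),
    hβ.poly.mono fun n => Nat.card_le_card_of_injective _ (hf n)⟩

theorem PolyWires.left {α β : ℕ → Type} (h : PolyWires fun n => α n ⊕ β n) : PolyWires α :=
  h.of_injective (fun _ => Sum.inl) fun _ => Sum.inl_injective

theorem PolyWires.right {α β : ℕ → Type} (h : PolyWires fun n => α n ⊕ β n) : PolyWires β :=
  h.of_injective (fun _ => Sum.inr) fun _ => Sum.inr_injective

theorem PolyBounded.polyWires {l : ℕ → ℕ} (h : PolyBounded l) : PolyWires fun n => Fin (l n) :=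
  ⟨fun _ => inferInstance, by simpa using h⟩

instance PolyWires.of_finite (α : Type) [Finite α] : PolyWires fun _ => α :=
  ⟨fun _ => inferInstance, PolyBounded.const _⟩

instance PolyWires.sum {α β : ℕ → Type} [hα : PolyWires α] [hβ : PolyWires β] :
    PolyWires fun n => α n ⊕ β n := by
  have := hα.finite
  have := hβ.finite
  exact ⟨fun _ => inferInstance, by simpa using hα.poly.add hβ.poly⟩

instance PolyWires.prod {α β : ℕ → Type} [hα : PolyWires α] [hβ : PolyWires β] :
    PolyWires fun n => α n × β n := by
  have := hα.finite
  have := hβ.finite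
  exact ⟨fun _ => inferInstance, by simpa using hα.poly.mul hβ.poly⟩

/-! Efficiently computable functions -/

/-- Families of randomized functions that circuits of polynomial size compute. -/
def Efficient {α β : ℕ → Type} (F : ∀ n, Bits (α n) → PMF (Bits (β n))) : Prop :=
  ∃ C : ∀ n, Circuit (α n) (β n), IsPPT C ∧ ∀ n x, (C n).eval x = F n x

/-- Families of functions that circuits of polynomial size compute. -/
def Feasible {α β : ℕ → Type} (f : ∀ n, Bits (α n) → Bits (β n)) : Prop :=
  Efficient fun n x => PMF.pure (f n x)

section
variable {α β γ : ℕ → Type}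

theorem Efficient.congr {F G : ∀ n, Bits (α n) → PMF (Bits (β n))} (hF : Efficient F)
    (h : ∀ n x, F n x = G n x) : Efficient G := by
  obtain ⟨C, hC, hCF⟩ := hF
  exact ⟨C, hC, fun n x => (hCF n x).trans (h n x)⟩

theorem IsPPT.efficient {C : ∀ n, Circuit (α n) (β n)} (hC : IsPPT C) :
    Efficient fun n x => (C n).eval x := ⟨C, hC, fun _ _ => rfl⟩

theorem Efficient.comp {F : ∀ n, Bits (β n) → PMF (Bits (γ n))} (hF : Efficient F)
    {f : ∀ n, Bits (α n) → Bits (β n)} (hf : Feasible f) : Efficient fun n x => F n (f n x) := by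
  obtain ⟨C, hC, hCF⟩ := hF
  obtain ⟨B, hB, hBf⟩ := hf
  exact ⟨fun n => (B n).comp (C n), hB.add hC, fun n x => by simp [Circuit.eval, hBf, hCF]⟩

theorem Feasible.comp {g : ∀ n, Bits (β n) → Bits (γ n)} (hg : Feasible g)
    {f : ∀ n, Bits (α n) → Bits (β n)} (hf : Feasible f) : Feasible fun n x => g n (f n x) :=
  Efficient.comp hg hf

theorem IsPPT.eval {C : ∀ n, Circuit (β n) (γ n)} (hC : IsPPT C)
    {f : ∀ n, Bits (α n) → Bits (β n)} (hf : Feasible f) :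
    Efficient fun n x => (C n).eval (f n x) := hC.efficient.comp hf

theorem Feasible.wire [hβ : PolyWires β] (σ : ∀ n, β n → α n) :
    Feasible fun n (x : Bits (α n)) => x ∘ σ n := by
  have := hβ.finite
  have := fun n => Fintype.ofFinite (β n)
  exact ⟨fun n => .wire (σ n), by simpa [IsPPT, Circuit.size] using hβ.poly, fun _ _ => rfl⟩

theorem Feasible.id [PolyWires α] : Feasible fun n (x : Bits (α n)) => x :=
  Feasible.wire fun _ => _root_.id

theorem Feasible.comp_wire [PolyWires γ] {f : ∀ n, Bits (α n) → Bits (β n)} (hf : Feasible f)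
    (σ : ∀ n, γ n → β n) : Feasible fun n x => f n x ∘ σ n := (Feasible.wire σ).comp hf

/-- Both circuits need the input, so it is duplicated by wires; this is where its length must be
polynomial. The two runs use independent coins. -/
theorem Efficient.prod [PolyWires α] {F : ∀ n, Bits (α n) → PMF (Bits (β n))}
    {G : ∀ n, Bits (α n) → PMF (Bits (γ n))} (hF : Efficient F) (hG : Efficient G) :
    Efficient fun n x => (F n x).bind fun y => (G n x).map fun z => Sum.elim y z := by
  obtain ⟨B, hB, hBF⟩ := hF
  obtain ⟨C, hC, hCG⟩ := hG
  have h : Efficient fun n (x : Bits (α n ⊕ α n)) => ((B n).par (C n)).eval x :=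
    IsPPT.efficient (hB.add hC)
  refine (h.comp (Feasible.wire fun n => Sum.elim _root_.id _root_.id)).congr fun n x => ?_
  simp [Circuit.eval, ← hBF, ← hCG, Function.comp_assoc]

theorem Feasible.elim [PolyWires α] {f : ∀ n, Bits (α n) → Bits (β n)}
    {g : ∀ n, Bits (α n) → Bits (γ n)} (hf : Feasible f) (hg : Feasible g) :
    Feasible fun n x => (Sum.elim (f n x) (g n x) : Bits (β n ⊕ γ n)) :=
  (Efficient.prod hf hg).congr fun n x => by simp [PMF.pure_map]

/-- The continuation may use the original input as well as the new value, so a copy of the input is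
carried along. Programs with local variables can then be treated one step at a time. -/
theorem Efficient.bind [PolyWires α] {F : ∀ n, Bits (α n) → PMF (Bits (β n))}
    {G : ∀ n, Bits (α n) → Bits (β n) → PMF (Bits (γ n))} (hF : Efficient F)
    (hG : Efficient fun n (x : Bits (α n ⊕ β n)) => G n (x ∘ Sum.inl) (x ∘ Sum.inr)) :
    Efficient fun n x => (F n x).bind (G n x) := by
  obtain ⟨C, hC, hCG⟩ := hG
  obtain ⟨B, hB, hBF⟩ := Efficient.prod Feasible.id hF
  refine ⟨fun n => (B n).comp (C n), hB.add hC, fun n x => ?_⟩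
  simp [Circuit.eval, hBF, hCG, PMF.bind_map, Function.comp_def]

theorem Efficient.andThen {F : ∀ n, Bits (α n) → PMF (Bits (β n))}
    {G : ∀ n, Bits (β n) → PMF (Bits (γ n))} (hF : Efficient F) (hG : Efficient G) :
    Efficient fun n x => (F n x).bind (G n) := by
  obtain ⟨B, hB, hBF⟩ := hF
  obtain ⟨C, hC, hCG⟩ := hG
  exact ⟨fun n => (B n).comp (C n), hB.add hC, fun n x => by
    simp only [Circuit.eval, hBF, funext (hCG n)]⟩

theorem Efficient.ite [PolyWires α] {b : ∀ n, Bits (α n) → Bool}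
    {F G : ∀ n, Bits (α n) → PMF (Bits (β n))} (hb : Feasible fun n x (_ : Unit) => b n x)
    (hF : Efficient F) (hG : Efficient G) :
    Efficient fun n x => if b n x then F n x else G n x := by
  obtain ⟨B, hB, hBF⟩ := hF
  obtain ⟨C, hC, hCG⟩ := hG
  have h : Efficient fun n (x : Bits (Unit ⊕ α n)) => ((B n).mux (C n)).eval x :=
    IsPPT.efficient ((hB.add hC).add (PolyBounded.const 1))
  refine (h.comp (hb.elim Feasible.id)).congr fun n x => ?_
  simp only [Circuit.eval, Sum.elim_inl, Sum.elim_comp_inr, hBF, hCG]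

theorem Feasible.ite [PolyWires α] {b : ∀ n, Bits (α n) → Bool}
    {f g : ∀ n, Bits (α n) → Bits (β n)} (hb : Feasible fun n x (_ : Unit) => b n x)
    (hf : Feasible f) (hg : Feasible g) :
    Feasible fun n x => if b n x then f n x else g n x :=
  (Efficient.ite hb hf hg).congr fun _ _ => (apply_ite PMF.pure _ _ _).symm

/-- Non-uniformity enters here: one false and one true gate suffice, and the advice string is
encoded in the wiring. Attackers get the asset and the auxiliary input hardwired this way. -/
theorem Feasible.const [hβ : PolyWires β] (c : ∀ n, Bits (β n)) :
    Feasible fun n (_ : Bits (α n)) => c n := by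
  have h : Efficient fun n (x : Bits (α n)) =>
      (((Circuit.wire (Sum.elim Empty.elim Empty.elim)).comp
        ((Circuit.const false).par (Circuit.const true)) : Circuit (α n) (Unit ⊕ Unit))).eval x :=
    IsPPT.efficient (by simpa [IsPPT, Circuit.size] using PolyBounded.const _)
  refine Efficient.congr (Efficient.andThen h (Feasible.wire fun n i =>
    if c n i then Sum.inr () else Sum.inl ())) fun n x => ?_
  simp only [Circuit.eval, PMF.pure_bind, PMF.pure_map]
  congr 1
  funext i
  cases h : c n i <;> simp [h]

end

/-! The equality test -/

theorem Circuit.exists_bitEq : ∃ C : Circuit (Unit ⊕ Unit) Unit, C.size = 5 ∧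
    ∀ x, C.eval x = PMF.pure fun _ => decide (x (.inl ()) = x (.inr ())) := by
  -- If the first bit is true, output the second; otherwise output its negation, a NAND of two
  -- copies.
  refine ⟨(wire _root_.id).mux ((wire fun _ => ()).comp nand), by simp [size], fun x => ?_⟩
  cases h : x (.inl ()) <;> cases h' : x (.inr ()) <;>
    simp [eval, h, h'] <;> congr 1 <;> funext i <;> simp [h']

theorem Circuit.exists_and : ∃ C : Circuit (Unit ⊕ Unit) Unit, C.size = 4 ∧
    ∀ x, C.eval x = PMF.pure fun _ => x (.inl ()) && x (.inr ()) :=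
  ⟨nand.comp ((wire fun _ => ()).comp nand), by simp [size], fun x => by simp [eval]⟩

/-- Compare the first bits, recurse on the tails, and take the conjunction. Rewiring at length `m +
1` costs `2 * m + 2` and the gates cost 9, whence a quadratic bound. -/
theorem Circuit.exists_eq (m : ℕ) : ∃ C : Circuit (Fin m ⊕ Fin m) Unit,
    C.size ≤ (m + 1) * (m + 11) ∧
      ∀ x, C.eval x = PMF.pure fun _ => decide (x ∘ Sum.inl = x ∘ Sum.inr) := by
  induction m with
  | zero =>
    refine ⟨(wire (Sum.elim Empty.elim Empty.elim)).comp
      (((const true).par (const true)).comp (wire Sum.inl)), by simp [size], fun x => ?_⟩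
    simp only [eval, PMF.pure_bind, PMF.pure_map, Sum.elim_comp_inl]
    congr 1
  | succ m ih =>
    obtain ⟨C, hs, hC⟩ := ih
    obtain ⟨E, hEs, hE⟩ := exists_bitEq
    obtain ⟨K, hKs, hK⟩ := exists_and
    refine ⟨(wire (Sum.elim (Sum.map (fun _ => 0) fun _ => 0) (Sum.map Fin.succ Fin.succ))).comp
      ((E.par C).comp K), ?_, fun x => ?_⟩
    · simp only [size, hEs, hKs, Fintype.card_sum, Fintype.card_unit, Fintype.card_fin]
      nlinarith
    · simp only [eval, PMF.pure_bind, PMF.pure_map, hE, hC, hK, Sum.elim_inl, Sum.elim_inr]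
      congr 1
      funext
      rw [← Bool.decide_and]
      simp [funext_iff, Fin.forall_fin_succ]

/-- Needed because simulating an ideal channel means testing whether the ciphertext came through
unchanged. -/
theorem Feasible.eq {α : ℕ → Type} [PolyWires α] {m : ℕ → ℕ} [hm : PolyWires fun n => Fin (m n)]
    {f g : ∀ n, Bits (α n) → Bits (Fin (m n))} (hf : Feasible f) (hg : Feasible g) :
    Feasible fun n x (_ : Unit) => decide (f n x = g n x) := by
  choose C hs hC using Circuit.exists_eq
  have hp : PolyBounded m := by simpa using hm.poly
  have h : Feasible fun n (x : Bits (Fin (m n) ⊕ Fin (m n))) (_ : Unit) =>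
      decide (x ∘ Sum.inl = x ∘ Sum.inr) :=
    ⟨fun n => C (m n), ((hp.add (.const 1)).mul (hp.add (.const 11))).mono fun n => hs (m n),
      fun n x => hC (m n) x⟩
  exact h.comp (hf.elim hg)

end Puppy

namespace Puppy

/-! Channel experiments with arbitrary efficient attackers -/

@[simp] theorem toOption_ofOption {α : Type} (m : Option (Bits α)) : toOption (ofOption m) = m := by
  cases m <;> simp [toOption, ofOption]

/-- Turns a case distinction on an optional string into a test of one wire, which a multiplexer can
perform. -/
theorem toOption_elim {α β : Type} (x : Bits (Unit ⊕ α)) (a : β) (f : Bits α → β) :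
    (toOption x).elim a f = if x (.inl ()) then f (x ∘ .inr) else a := by
  unfold toOption
  split <;> rfl

theorem PMF_pure_eq {α : Type} (a : α) : (pure a : PMF α) = PMF.pure a := rfl

theorem PMF_bind_eq {α β : Type} (p : PMF α) (f : α → PMF β) : p >>= f = p.bind f := rfl

namespace Channel
variable {M : ℕ → Type} (ch : Channel M) {St : ℕ → Type}

/-- The attack on the actual encryption, for an attacker given by its input-output behaviour. -/
noncomputable def realExperiment (n : ℕ) (choose : PMF (Bits (St n ⊕ M n)))
    (tamper : Bits (St n) → Bits (Fin (ch.ctLen n)) → PMF (Bits (St n ⊕ Fin (ch.ctLen n))))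
    (guess : Bits (St n) → Option (Bits (M n)) → PMF (Bits Unit)) : PMF (Bits Unit) :=
  choose.bind fun x => (ch.newKey n).bind fun k => (ch.encrypt n k (x ∘ .inr)).bind fun c =>
    (tamper (x ∘ .inl) c).bind fun y => (ch.decrypt n k (y ∘ .inr)).bind fun m =>
      guess (y ∘ .inl) m

/-- The attack on an ideal channel, for an attacker given by its input-output behaviour. -/
noncomputable def idealExperiment (n : ℕ) (choose : PMF (Bits (St n ⊕ M n)))
    (tamper : Bits (St n) → Bits (Fin (ch.ctLen n)) → PMF (Bits (St n ⊕ Fin (ch.ctLen n))))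
    (guess : Bits (St n) → Option (Bits (M n)) → PMF (Bits Unit)) : PMF (Bits Unit) :=
  choose.bind fun x => (ch.newKey n).bind fun k => (ch.encrypt n k fun _ => false).bind fun c =>
    (tamper (x ∘ .inl) c).bind fun y =>
      guess (y ∘ .inl) (if y ∘ Sum.inr = c then some (x ∘ .inr) else none)

variable {ch} in
-- Lets attackers be written as probabilistic functions; the circuits demanded by `Channel.Attacker`
-- are extracted from the efficiency hypotheses.
theorem Secure.negligible_experiment (h : ch.Secure) [hSt : PolyWires St]
    {choose : ∀ n, PMF (Bits (St n ⊕ M n))}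
    {tamper : ∀ n, Bits (St n) → Bits (Fin (ch.ctLen n)) → PMF (Bits (St n ⊕ Fin (ch.ctLen n)))}
    {guess : ∀ n, Bits (St n) → Option (Bits (M n)) → PMF (Bits Unit)}
    (hchoose : Efficient fun n (_ : Bits Empty) => choose n)
    (htamper : Efficient fun n (x : Bits (St n ⊕ Fin (ch.ctLen n))) =>
      tamper n (x ∘ .inl) (x ∘ .inr))
    (hguess : Efficient fun n (x : Bits (St n ⊕ (Unit ⊕ M n))) =>
      guess n (x ∘ .inl) (toOption (x ∘ .inr))) :
    Negligible fun n => |prOne (ch.realExperiment n (choose n) (tamper n) (guess n)) -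
      prOne (ch.idealExperiment n (choose n) (tamper n) (guess n))| := by
  obtain ⟨C, hC, hCeq⟩ := hchoose
  obtain ⟨T, hT, hTeq⟩ := htamper
  obtain ⟨G, hG, hGeq⟩ := hguess
  have := hSt.finite
  have := fun n => Fintype.ofFinite (St n)
  refine (congrArg Negligible (funext fun n => ?_)).mp (h ⟨St, C, T, G, hC, hT, hG⟩)
  simp only [realGame, idealGame, realExperiment, idealExperiment, PMF_bind_eq, hCeq, hTeq, hGeq,
    Sum.elim_comp_inl, Sum.elim_comp_inr, toOption_ofOption]

end Channel

/-! ### Protocol data as strings of polynomial length -/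

namespace Instance
variable {I : Instance}

instance : PolyWires I.Asset := I.wm.insert_ppt.polyWires
instance : PolyWires I.Sec := I.wm.secretGen_ppt.polyWires
instance : PolyWires I.HashKey := I.ids.hash.keyGen_ppt.polyWires
instance : PolyWires I.Id := I.ids.hash.hash_ppt.polyWires
instance : PolyWires I.TokenH := I.ss.share_ppt.polyWires.left
instance : PolyWires I.TokenP := I.ss.share_ppt.polyWires.right
instance : PolyWires I.CtUp := I.tee.up.enc_ppt.polyWires
instance : PolyWires I.CtDown := I.tee.down.enc_ppt.polyWires
instance {auxLen outLen : ℕ → ℕ} (A : I.MaliciousProver auxLen outLen) : PolyWires A.St :=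
  A.start_ppt.polyWires.left
instance : PolyWires fun n => Fin (I.tee.up.keyLen n) := I.tee.up.gen_ppt.polyWires
instance : PolyWires fun n => Fin (I.tee.down.keyLen n) := I.tee.down.gen_ppt.polyWires
instance : PolyWires fun n => Fin (I.ids.ownerLen n) := I.ids.ownerLen_poly.polyWires
instance : PolyWires fun n => Fin (I.ids.dateLen n) := I.ids.dateLen_poly.polyWires
instance : PolyWires fun n => Fin (I.ids.metaLen n) := I.ids.metadata_ppt.polyWires


/-- The wires that carry everything that ownership generation produces. -/
abbrev OwnerWires (I : Instance) (n : ℕ) : Type :=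
  I.HashKey n ⊕ (I.Id n ⊕ (I.Asset n ⊕ (I.Sec n ⊕ (I.TokenH n ⊕ I.TokenP n))))

section
variable {n : ℕ}

def Ownership.bits (g : I.Ownership n) : Bits (I.OwnerWires n) :=
  Sum.elim g.hk (Sum.elim g.id (Sum.elim g.Dw (Sum.elim g.sec (Sum.elim g.tkH g.tkP))))

def Ownership.ofBits (b : Bits (I.OwnerWires n)) : I.Ownership n where
  hk := b ∘ .inl
  id := b ∘ .inr ∘ .inl
  Dw := b ∘ .inr ∘ .inr ∘ .inl
  sec := b ∘ .inr ∘ .inr ∘ .inr ∘ .inl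
  tkH := b ∘ .inr ∘ .inr ∘ .inr ∘ .inr ∘ .inl
  tkP := b ∘ .inr ∘ .inr ∘ .inr ∘ .inr ∘ .inr

@[simp] theorem Ownership.ofBits_bits (g : I.Ownership n) : ofBits g.bits = g := rfl

/-- The holder's request to the enclave. -/
def Ownership.request (g : I.Ownership n) : Bits (I.Id n ⊕ (I.Asset n ⊕ I.TokenH n)) :=
  Sum.elim g.id (Sum.elim g.Dw g.tkH)

end

theorem detectWithTokens_bind (n : ℕ) {α : Type} (Dw : Bits (I.Asset n)) (tkH : Bits (I.TokenH n))
    (tkP : Bits (I.TokenP n)) (F : Bool → PMF α) :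
    (I.detectWithTokens n Dw tkH tkP).bind F =
      ((I.ss.reconst n).eval (Sum.elim tkH tkP)).bind fun sec =>
        ((I.wm.detect n).eval (Sum.elim Dw sec)).bind fun r => F (r ()) := by
  simp only [detectWithTokens, PMF_bind_eq, PMF_pure_eq, PMF.bind_bind, PMF.pure_bind]

/-! ### The prover's steps with a flag, the simulator and the enclave's answer -/

section
variable {auxLen outLen : ℕ → ℕ} (A : I.MaliciousProver auxLen outLen) (n : ℕ)

/-- The prover's start on the owner's message, with a bit that says whether verification goes
on. -/
noncomputable def runStart (aux : Bits (Fin (auxLen n))) (hk : Bits (I.HashKey n))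
    (id : Bits (I.Id n)) (tkP : Bits (I.TokenP n)) : PMF (Bits (A.St n ⊕ Unit)) :=
  (A.start n).eval (Sum.elim aux (Sum.elim hk (Sum.elim id tkP)))

/-- Delivery of the holder's ciphertext, if verification goes on. -/
noncomputable def deliverUp (s : Bits (A.St n ⊕ Unit)) (c : Bits (I.CtUp n)) :
    PMF (Bits ((A.St n ⊕ Unit) ⊕ I.CtUp n)) :=
  if s (.inr ()) then
    ((A.onRequest n).eval (Sum.elim (s ∘ .inl) c)).bind fun x =>
      PMF.pure (Sum.elim (Sum.elim (x ∘ .inl) fun _ => x (.inr (.inl ()))) (x ∘ .inr ∘ .inr))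
  -- After a stop the ciphertext passes unchanged, so a comparison on an ideal channel succeeds and
  -- the cleared flag stays as it is.
  else PMF.pure (Sum.elim s c)

/-- Delivery of the enclave's ciphertext, if verification goes on. -/
noncomputable def deliverDown (s : Bits (A.St n ⊕ Unit)) (c : Bits (I.CtDown n)) :
    PMF (Bits ((A.St n ⊕ Unit) ⊕ I.CtDown n)) :=
  if s (.inr ()) then
    ((A.onResponse n).eval (Sum.elim (s ∘ .inl) c)).bind fun x =>
      PMF.pure (Sum.elim (Sum.elim (x ∘ .inl) fun _ => x (.inr (.inl ()))) (x ∘ .inr ∘ .inr))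
  else PMF.pure (Sum.elim s c)

/-- The delivery of the holder's ciphertext over an ideal channel. -/
noncomputable def simulateUp (s : Bits (A.St n ⊕ Unit)) : PMF (Bits (A.St n ⊕ Unit)) :=
  (I.tee.up.newKey n).bind fun k => (I.tee.up.encrypt n k fun _ => false).bind fun c =>
    (deliverUp A n s c).bind fun y =>
      PMF.pure (if decide (y ∘ Sum.inr = c) then y ∘ .inl
        else Sum.elim (y ∘ .inl ∘ .inl) fun _ => false)

/-- The delivery of the enclave's ciphertext over an ideal channel. -/
noncomputable def simulateDown (s : Bits (A.St n ⊕ Unit)) : PMF (Bits (A.St n ⊕ Unit)) :=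
  (I.tee.down.newKey n).bind fun k => (I.tee.down.encrypt n k fun _ => false).bind fun c =>
    (deliverDown A n s c).bind fun y =>
      PMF.pure (if decide (y ∘ Sum.inr = c) then y ∘ .inl
        else Sum.elim (y ∘ .inl ∘ .inl) fun _ => false)

/-- The enclave's query to the prover's database, if verification goes on. -/
noncomputable def fetch (s : Bits (A.St n ⊕ Unit)) (id : Bits (I.Id n)) :
    PMF (Bits (A.St n ⊕ (Unit ⊕ I.TokenP n))) :=
  if s (.inr ()) then (A.onFetch n).eval (Sum.elim (s ∘ .inl) id)
  else PMF.pure (Sum.elim (s ∘ .inl) fun _ => false)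

/-- The simulator: it runs the prover with ideal channels, and its database holds the token that
the prover provides if both ciphertexts are delivered faithfully. -/
noncomputable def simulate (aux : Bits (Fin (auxLen n))) (hk : Bits (I.HashKey n))
    (id : Bits (I.Id n)) (tkP : Bits (I.TokenP n)) :
    PMF (Bits (I.Database 1 n ⊕ Fin (outLen n))) :=
  (runStart A n aux hk id tkP).bind fun s => (simulateUp A n s).bind fun s' =>
    (fetch A n s' id).bind fun f =>
      (simulateDown A n (Sum.elim (f ∘ .inl) fun _ => f (.inr (.inl ())))).bind fun t =>
        ((A.finish n).eval (t ∘ .inl)).bind fun out =>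
          -- The presence bit of the only slot is the flag that remains after both deliveries.
          PMF.pure (Sum.elim (Sum.elim (t ∘ .inr) (Sum.elim id (f ∘ .inr ∘ .inr)) ∘ Prod.snd) out)

/-- The prover's output and the distinguisher's decision. -/
noncomputable def conclude (D : Circuit (I.Joint outLen n) Unit) (g : I.Ownership n) (v : Verdict)
    (st : Bits (A.St n)) : PMF (Bits Unit) :=
  ((A.finish n).eval st).bind fun out => D.eval (joint g v out)

/-- The enclave's answer to an authentic request, if verification goes on. -/
noncomputable def answer (g : I.Ownership n) (s : Bits (A.St n ⊕ Unit)) :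
    PMF (Bits ((A.St n ⊕ Unit) ⊕ Unit)) :=
  (fetch A n s g.id).bind fun f =>
    if f (.inr (.inl ())) then
      (I.detectWithTokens n g.Dw g.tkH (f ∘ .inr ∘ .inr)).bind fun res =>
        PMF.pure (Sum.elim (Sum.elim (f ∘ .inl) fun _ => true) fun _ => res)
    -- The experiment needs a message even when no token was provided; the cleared flag makes this
    -- dummy bit irrelevant.
    else PMF.pure (Sum.elim (Sum.elim (f ∘ .inl) fun _ => false) fun _ => false)

/-! The attack on the holder's channel -/

/-- The owner's data are kept because the distinguisher's input includes them at the end. -/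
abbrev AttackState (n : ℕ) : Type := I.OwnerWires n ⊕ (A.St n ⊕ Unit)

noncomputable def upChoose (aux : Bits (Fin (auxLen n))) (Do : Bits (I.Asset n)) :
    PMF (Bits (AttackState A n ⊕ (I.Id n ⊕ (I.Asset n ⊕ I.TokenH n)))) :=
  (I.generate n Do).bind fun g => (runStart A n aux g.hk g.id g.tkP).bind fun s =>
    PMF.pure (Sum.elim (Sum.elim g.bits s) g.request)

noncomputable def upTamper (s : Bits (AttackState A n)) (c : Bits (I.CtUp n)) :
    PMF (Bits (AttackState A n ⊕ I.CtUp n)) :=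
  (deliverUp A n (s ∘ .inr) c).bind fun y =>
    PMF.pure (Sum.elim (Sum.elim (s ∘ .inl) (y ∘ .inl)) (y ∘ .inr))

/-- The attacker on the holder's channel plays the enclave itself, so it draws the key of the other
direction. -/
noncomputable def upGuess (D : Circuit (I.Joint outLen n) Unit) (s : Bits (AttackState A n))
    (m : Option (Bits (I.Id n ⊕ (I.Asset n ⊕ I.TokenH n)))) : PMF (Bits Unit) :=
  if s (.inr (.inr ())) then
    m.elim (conclude A n D (.ofBits (s ∘ .inl)) .abort (s ∘ .inr ∘ .inl)) fun req =>
      (I.tee.down.newKey n).bind fun k => (realEnclave A n (s ∘ .inr ∘ .inl) k req).bind fun v =>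
        conclude A n D (.ofBits (s ∘ .inl)) v.1 v.2
  else conclude A n D (.ofBits (s ∘ .inl)) .abort (s ∘ .inr ∘ .inl)

/-! The attack on the enclave's channel -/

/-- The first channel is already ideal here: the only request that can reach the enclave is the
authentic one, and `answer` works directly from the owner's data. -/
noncomputable def downChoose (aux : Bits (Fin (auxLen n))) (Do : Bits (I.Asset n)) :
    PMF (Bits (AttackState A n ⊕ Unit)) :=
  (I.generate n Do).bind fun g => (runStart A n aux g.hk g.id g.tkP).bind fun s =>
    (simulateUp A n s).bind fun s' => (answer A n g s').bind fun y =>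
      PMF.pure (Sum.elim (Sum.elim g.bits (y ∘ .inl)) (y ∘ .inr))

noncomputable def downTamper (s : Bits (AttackState A n)) (c : Bits (I.CtDown n)) :
    PMF (Bits (AttackState A n ⊕ I.CtDown n)) :=
  (deliverDown A n (s ∘ .inr) c).bind fun y =>
    PMF.pure (Sum.elim (Sum.elim (s ∘ .inl) (y ∘ .inl)) (y ∘ .inr))

noncomputable def downGuess (D : Circuit (I.Joint outLen n) Unit) (s : Bits (AttackState A n))
    (m : Option (Bits Unit)) : PMF (Bits Unit) :=
  if s (.inr (.inr ())) then
    m.elim (conclude A n D (.ofBits (s ∘ .inl)) .abort (s ∘ .inr ∘ .inl)) fun r =>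
      conclude A n D (.ofBits (s ∘ .inl)) (.ofRes (r ())) (s ∘ .inr ∘ .inl)
  else conclude A n D (.ofBits (s ∘ .inl)) .abort (s ∘ .inr ∘ .inl)

/-! The hybrid argument -/

theorem realRespond_bind {α : Type} (st : Bits (A.St n)) (k : Bits (Fin (I.tee.down.keyLen n)))
    (res : Bool) (F : Verdict × Bits (A.St n) → PMF α) :
    (realRespond A n st k res).bind F =
      (I.tee.down.encrypt n k fun _ => res).bind fun c =>
        ((A.onResponse n).eval (Sum.elim st c)).bind fun x =>
          if x (.inr (.inl ())) then
            (I.tee.down.decrypt n k (x ∘ .inr ∘ .inr)).bind fun m =>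
              m.elim (F (.abort, x ∘ .inl)) fun r => F (.ofRes (r ()), x ∘ .inl)
          else F (.abort, x ∘ .inl) := by
  simp only [realRespond, PMF_bind_eq, PMF_pure_eq, PMF.bind_bind]
  refine congrArg _ (funext fun c => congrArg _ (funext fun x => ?_))
  by_cases h : x (.inr (.inl ())) = true
  · simp only [toOption, Function.comp_apply, h, if_true, PMF.bind_bind]
    refine congrArg _ (funext fun m => ?_)
    cases m <;> simp
  · simp [toOption, h]

theorem realEnclave_bind {α : Type} (st : Bits (A.St n)) (k : Bits (Fin (I.tee.down.keyLen n)))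
    (req : Bits (I.Id n ⊕ (I.Asset n ⊕ I.TokenH n))) (F : Verdict × Bits (A.St n) → PMF α) :
    (realEnclave A n st k req).bind F =
      ((A.onFetch n).eval (Sum.elim st (req ∘ .inl))).bind fun x =>
        if x (.inr (.inl ())) then
          (I.detectWithTokens n (req ∘ .inr ∘ .inl) (req ∘ .inr ∘ .inr) (x ∘ .inr ∘ .inr)).bind
            fun res => (realRespond A n (x ∘ .inl) k res).bind F
        else F (.abort, x ∘ .inl) := by
  simp only [realEnclave, PMF_bind_eq, PMF_pure_eq, PMF.bind_bind]
  refine congrArg _ (funext fun x => ?_)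
  by_cases h : x (.inr (.inl ())) = true
  · simp only [toOption, Function.comp_apply, h, if_true, PMF.bind_bind, Function.comp_assoc]
  · simp [toOption, h]

/-- The protocol and the experiment differ in the moment at which the enclave's channel key is
drawn, and in idle steps whose results are discarded after a stop. -/
theorem real_bind (D : Circuit (I.Joint outLen n) Unit) (aux : Bits (Fin (auxLen n)))
    (Do : Bits (I.Asset n)) :
    (real A n aux Do).bind D.eval =
      I.tee.up.realExperiment (St := AttackState A) n (upChoose A n aux Do) (upTamper A n)
        (upGuess A n D) := by
  simp only [real, Channel.realExperiment, upChoose, runStart, PMF_bind_eq, PMF_pure_eq,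
    PMF.bind_bind, PMF.pure_bind]
  refine congrArg _ (funext fun g => congrArg _ (funext fun x => ?_))
  simp only [Sum.elim_comp_inl, Sum.elim_comp_inr, upTamper, deliverUp]
  by_cases h : x (.inr ()) = true
  · simp only [h, if_true, realVerify, PMF_bind_eq, PMF_pure_eq, PMF.bind_bind, PMF.pure_bind,
      Sum.elim_comp_inl, Sum.elim_comp_inr, Ownership.request]
    refine congrArg _ (funext fun k => ?_)
    -- The enclave's key is independent of the request phase; it moves past the encryption here,
    -- then past the prover's step and the decryption.
    rw [PMF.bind_comm]
    refine congrArg _ (funext fun c => ?_)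
    rw [PMF.bind_comm]
    refine congrArg _ (funext fun y => ?_)
    by_cases h' : y (.inr (.inl ())) = true
    · simp only [toOption, Function.comp_apply, h', if_true, PMF.bind_bind,
        Function.comp_assoc]
      rw [PMF.bind_comm]
      refine congrArg _ (funext fun m => ?_)
      cases m <;> simp [upGuess, conclude, ← Function.comp_assoc]
    · simp [toOption, h', upGuess, conclude, ← Function.comp_assoc]
  · simp [h, upGuess, conclude, ← Function.comp_assoc]

theorem upGuess_none (D : Circuit (I.Joint outLen n) Unit) (g : I.Ownership n)
    (s : Bits (A.St n ⊕ Unit)) :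
    upGuess A n D (Sum.elim g.bits s) none = conclude A n D g .abort (s ∘ .inl) := by
  simp only [upGuess, Option.elim, Sum.elim_comp_inl, Sum.elim_comp_inr, ← Function.comp_assoc,
    Ownership.ofBits_bits, ite_self]

/-- With a cleared flag the prover is no longer called; a key is still drawn and a dummy sent, but
the outcome ignores both. -/
theorem downRespond_stopped (D : Circuit (I.Joint outLen n) Unit) (g : I.Ownership n)
    (s : Bits (A.St n ⊕ Unit)) (hs : s (.inr ()) = false) :
    (answer A n g s).bind (fun y => (I.tee.down.newKey n).bind fun k =>
      (I.tee.down.encrypt n k (y ∘ .inr)).bind fun c =>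
        (downTamper A n (Sum.elim g.bits (y ∘ .inl)) c).bind fun z =>
          (I.tee.down.decrypt n k (z ∘ .inr)).bind fun m => downGuess A n D (z ∘ .inl) m) =
      conclude A n D g .abort (s ∘ .inl) := by
  simp [answer, fetch, hs, downTamper, deliverDown, downGuess, ← Function.comp_assoc]

/-- On an authentic request the enclave's key may be drawn after fetching and detection, since
neither uses it. What follows is then an execution of the second channel's experiment. -/
theorem upGuess_some (D : Circuit (I.Joint outLen n) Unit) (g : I.Ownership n)
    (s : Bits (A.St n ⊕ Unit)) :
    upGuess A n D (Sum.elim g.bits s) (some g.request) =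
      (answer A n g s).bind fun y => (I.tee.down.newKey n).bind fun k =>
        (I.tee.down.encrypt n k (y ∘ .inr)).bind fun c =>
          (downTamper A n (Sum.elim g.bits (y ∘ .inl)) c).bind fun z =>
            (I.tee.down.decrypt n k (z ∘ .inr)).bind fun m => downGuess A n D (z ∘ .inl) m := by
  by_cases hs : s (.inr ()) = true
  · simp only [upGuess, answer, fetch, Sum.elim_inr, hs, if_true, Option.elim, PMF.bind_bind]
    simp only [realEnclave_bind, realRespond_bind, Ownership.request, Sum.elim_comp_inl,
      ← Function.comp_assoc, Sum.elim_comp_inr]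
    rw [PMF.bind_comm]
    refine congrArg _ (funext fun f => ?_)
    by_cases hf : f (.inr (.inl ())) = true
    · simp only [hf, if_true, PMF.bind_bind, PMF.pure_bind]
      rw [PMF.bind_comm]
      refine congrArg _ (funext fun res => congrArg _ (funext fun k => ?_))
      simp only [Sum.elim_comp_inl, Sum.elim_comp_inr, downTamper, deliverDown, Sum.elim_inr,
        if_true, PMF.bind_bind, PMF.pure_bind]
      refine congrArg _ (funext fun c => congrArg _ (funext fun x => ?_))
      by_cases hx : x (.inr (.inl ())) = true
      · simp only [hx, if_true, downGuess, Sum.elim_inr,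
          Sum.elim_comp_inl, Sum.elim_comp_inr, ← Function.comp_assoc, Ownership.ofBits_bits]
      · simp [hx, downGuess, ← Function.comp_assoc]
    · simp [hf, downTamper, deliverDown, downGuess, ← Function.comp_assoc]
  · have hs' : s (.inr ()) = false := by simpa using hs
    rw [downRespond_stopped A n D g s hs']
    simp [upGuess, hs', ← Function.comp_assoc]

theorem idealExperiment_up (D : Circuit (I.Joint outLen n) Unit) (aux : Bits (Fin (auxLen n)))
    (Do : Bits (I.Asset n)) :
    I.tee.up.idealExperiment (St := AttackState A) n (upChoose A n aux Do) (upTamper A n)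
        (upGuess A n D) =
      I.tee.down.realExperiment (St := AttackState A) n (downChoose A n aux Do) (downTamper A n)
        (downGuess A n D) := by
  simp only [Channel.idealExperiment, Channel.realExperiment, upChoose, downChoose, PMF.bind_bind,
    PMF.pure_bind, Sum.elim_comp_inl, Sum.elim_comp_inr, simulateUp, upTamper]
  refine congrArg _ (funext fun g => congrArg _ (funext fun s => congrArg _ (funext fun k =>
    congrArg _ (funext fun c => congrArg _ (funext fun y => ?_)))))
  by_cases h : y ∘ Sum.inr = c
  · simp only [h, if_true, decide_true]
    exact upGuess_some A n D g (y ∘ .inl)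
  · simp only [h, if_false, decide_false, Bool.false_eq_true]
    -- A modified ciphertext is rejected on one side; on the other `simulateUp` has cleared the
    -- flag, so the second experiment runs idly.
    rw [upGuess_none, downRespond_stopped _ _ _ _ _ rfl]
    simp [Function.comp_assoc]

/-- Honest generation always yields a matching identifier, so the functionality's identifier check
never fails. -/
theorem generate_bind_congr {α : Type} {Do : Bits (I.Asset n)} {F G : I.Ownership n → PMF α}
    (h : ∀ g, g.id = I.ids.idGen n g.hk g.Dw → F g = G g) :
    (I.generate n Do).bind F = (I.generate n Do).bind G := by
  simp only [generate, PMF_bind_eq, PMF_pure_eq, PMF.bind_bind, PMF.pure_bind]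
  exact congrArg _ (funext fun hk => congrArg _ (funext fun sec => congrArg _ (funext fun Dw =>
    congrArg _ (funext fun tk => h _ rfl))))

theorem lookup_single (b : Bits Unit) (id : Bits (I.Id n)) (tkP : Bits (I.TokenP n)) :
    lookup (k := 1) (Sum.elim b (Sum.elim id tkP) ∘ Prod.snd) id =
      if b () then some tkP else none := by
  cases h : b () <;> simp [lookup, toOption, List.finRange_succ, h, Function.comp_def]

/-- The simulator never sees the detection result. In the experiment that result is computed early,
but the ideal ciphertext does not depend on it, so the computation can be postponed to the
functionality's turn. -/
theorem ideal_bind (D : Circuit (I.Joint outLen n) Unit)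
    (run : ∀ n, Circuit (Fin (auxLen n) ⊕ (I.HashKey n ⊕ (I.Id n ⊕ I.TokenP n)))
      (I.Database 1 n ⊕ Fin (outLen n))) (run_ppt : IsPPT run)
    (run_eval : ∀ x, (run n).eval x = simulate A n (x ∘ .inl) (x ∘ .inr ∘ .inl)
      (x ∘ .inr ∘ .inr ∘ .inl) (x ∘ .inr ∘ .inr ∘ .inr))
    (aux : Bits (Fin (auxLen n))) (Do : Bits (I.Asset n)) :
    (ideal ⟨fun _ => 1, run, run_ppt⟩ n aux Do).bind D.eval =
      I.tee.down.idealExperiment (St := AttackState A) n (downChoose A n aux Do) (downTamper A n)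
        (downGuess A n D) := by
  simp only [ideal, Channel.idealExperiment, downChoose, PMF_bind_eq, PMF_pure_eq, PMF.bind_bind,
    PMF.pure_bind, run_eval, simulate, ← Function.comp_assoc, Sum.elim_comp_inl,
    Sum.elim_comp_inr]
  refine generate_bind_congr n fun g hg => congrArg _ (funext fun s => congrArg _ (funext fun s' =>
    ?_))
  simp only [answer, PMF.bind_bind, idealVerify, hg, ne_eq, not_true_eq_false, if_false]
  -- Undoes the rewriting of the identifier where it serves as database key.
  rw [← hg]
  refine congrArg _ (funext fun f => ?_)
  simp only [lookup_single, simulateDown, PMF.bind_bind, PMF.pure_bind]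
  by_cases hf : f (.inr (.inl ())) = true
  · simp only [hf, if_true, PMF.bind_bind, PMF.pure_bind, Sum.elim_comp_inl, Sum.elim_comp_inr,
      downTamper]
    -- Detection moves past the key, then past the ciphertext and its delivery, and finally is
    -- exchanged with the prover's last step.
    rw [PMF.bind_comm]
    refine congrArg _ (funext fun k => ?_)
    rw [PMF.bind_comm (I.detectWithTokens n g.Dw g.tkH _)]
    refine congrArg _ (funext fun c => ?_)
    rw [PMF.bind_comm (I.detectWithTokens n g.Dw g.tkH _)]
    refine congrArg _ (funext fun y => ?_)
    simp only [← Function.comp_assoc]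
    by_cases hy : y ∘ Sum.inr = c
    · by_cases hy' : y (.inl (.inr ())) = true
      · simp only [hy, decide_true, if_true, Function.comp_apply, hy', PMF.bind_map, downGuess,
          conclude, Sum.elim_inr, Option.elim]
        rw [PMF.bind_comm]
        simp [Function.comp_def]
      -- When the flag is cleared, the slot is empty and both verdicts are abort; the detection
      -- result is discarded.
      · simp [hy, hy', downGuess, conclude, ← Function.comp_assoc]
    · simp [hy, downGuess, conclude, ← Function.comp_assoc]
  · simp [hf, downTamper, deliverDown, downGuess, ← Function.comp_assoc, conclude]

end

end Instance

end Puppy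

namespace Puppy
namespace Instance

/-! Efficiency of the simulator and of the attackers -/

section
variable {I : Instance} {auxLen outLen : ℕ → ℕ} (A : I.MaliciousProver auxLen outLen)
  {Γ : ℕ → Type}

theorem efficient_newKey {M : ℕ → Type} (ch : Channel M) :
    Efficient fun n (_ : Bits (Γ n)) => ch.newKey n :=
  ch.gen_ppt.eval (Feasible.const _)

theorem decrypt_bind {M : ℕ → Type} (ch : Channel M) {α : Type} (n : ℕ)
    (k : Bits (Fin (ch.keyLen n))) (c : Bits (Fin (ch.ctLen n))) (F : Option (Bits (M n)) → PMF α) :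
    (ch.decrypt n k c).bind F = ((ch.dec n).eval (Sum.elim k c)).bind fun m => F (toOption m) :=
  PMF.bind_map _ _ _

variable [PolyWires Γ]

theorem efficient_encrypt {M : ℕ → Type} (ch : Channel M)
    {k : ∀ n, Bits (Γ n) → Bits (Fin (ch.keyLen n))} {m : ∀ n, Bits (Γ n) → Bits (M n)}
    (hk : Feasible k) (hm : Feasible m) : Efficient fun n x => ch.encrypt n (k n x) (m n x) :=
  ch.enc_ppt.eval (hk.elim hm)

/-- The result is a `Bool`, not a string, so efficiency is stated for detection together with its
continuation, which reads the bit from a wire. -/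
theorem efficient_detectWithTokens_bind {α : ℕ → Type} {Dw : ∀ n, Bits (Γ n) → Bits (I.Asset n)}
    {tkH : ∀ n, Bits (Γ n) → Bits (I.TokenH n)} {tkP : ∀ n, Bits (Γ n) → Bits (I.TokenP n)}
    {F : ∀ n, Bits (Γ n) → Bool → PMF (Bits (α n))} (hDw : Feasible Dw) (htkH : Feasible tkH)
    (htkP : Feasible tkP)
    (hF : Efficient fun n (x : Bits (Γ n ⊕ Unit)) => F n (x ∘ .inl) (x (.inr ()))) :
    Efficient fun n x =>
      (I.detectWithTokens n (Dw n x) (tkH n x) (tkP n x)).bind (F n x) := by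
  have h : Efficient fun n x => ((I.ss.reconst n).eval (Sum.elim (tkH n x) (tkP n x))).bind
      fun sec => (I.wm.detect n).eval (Sum.elim (Dw n x) sec) :=
    .bind (I.ss.reconst_ppt.eval (htkH.elim htkP)) (I.wm.detect_ppt.eval
      ((hDw.comp (.comp_wire .id fun _ => Sum.inl)).elim (.comp_wire .id fun _ => Sum.inr)))
  refine (h.bind (G := fun n x r => F n x (r ())) hF).congr fun n x => ?_
  rw [detectWithTokens_bind, PMF.bind_bind]

/-- The circuit is built on bare input wires and composed with `s` and `c` only at the end; the
remaining goals then concern nothing but wiring and constants. -/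
theorem efficient_deliverUp {s : ∀ n, Bits (Γ n) → Bits (A.St n ⊕ Unit)}
    {c : ∀ n, Bits (Γ n) → Bits (I.CtUp n)} (hs : Feasible s) (hc : Feasible c) :
    Efficient fun n x => deliverUp A n (s n x) (c n x) := by
  have h : Efficient fun n (x : Bits ((A.St n ⊕ Unit) ⊕ I.CtUp n)) =>
      deliverUp A n (x ∘ .inl) (x ∘ .inr) := by
    unfold deliverUp
    refine .ite ?_ (.bind (A.onRequest_ppt.eval ?_) ?_) ?_
    all_goals
    repeat' first
      | exact Feasible.const _
      | exact Feasible.id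
      | apply Feasible.elim
      | apply Feasible.comp_wire
  exact h.comp (hs.elim hc)

theorem efficient_deliverDown {s : ∀ n, Bits (Γ n) → Bits (A.St n ⊕ Unit)}
    {c : ∀ n, Bits (Γ n) → Bits (I.CtDown n)} (hs : Feasible s) (hc : Feasible c) :
    Efficient fun n x => deliverDown A n (s n x) (c n x) := by
  have h : Efficient fun n (x : Bits ((A.St n ⊕ Unit) ⊕ I.CtDown n)) =>
      deliverDown A n (x ∘ .inl) (x ∘ .inr) := by
    unfold deliverDown
    refine .ite ?_ (.bind (A.onResponse_ppt.eval ?_) ?_) ?_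
    all_goals
    repeat' first
      | exact Feasible.const _
      | exact Feasible.id
      | apply Feasible.elim
      | apply Feasible.comp_wire
  exact h.comp (hs.elim hc)

theorem efficient_fetch {s : ∀ n, Bits (Γ n) → Bits (A.St n ⊕ Unit)}
    {id : ∀ n, Bits (Γ n) → Bits (I.Id n)} (hs : Feasible s) (hid : Feasible id) :
    Efficient fun n x => fetch A n (s n x) (id n x) := by
  have h : Efficient fun n (x : Bits ((A.St n ⊕ Unit) ⊕ I.Id n)) =>
      fetch A n (x ∘ .inl) (x ∘ .inr) := by
    unfold fetch
    refine .ite ?_ (A.onFetch_ppt.eval ?_) ?_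
    all_goals
    repeat' first
      | exact Feasible.const _
      | exact Feasible.id
      | apply Feasible.elim
      | apply Feasible.comp_wire
  exact h.comp (hs.elim hid)

theorem efficient_simulateUp {s : ∀ n, Bits (Γ n) → Bits (A.St n ⊕ Unit)} (hs : Feasible s) :
    Efficient fun n x => simulateUp A n (s n x) := by
  have h : Efficient fun n (x : Bits (A.St n ⊕ Unit)) => simulateUp A n x := by
    unfold simulateUp
    refine .bind (efficient_newKey _) (.bind (efficient_encrypt _ ?_ ?_)
      (.bind (efficient_deliverUp A ?_ ?_) (Feasible.ite (.eq ?_ ?_) ?_ ?_)))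
    all_goals
    repeat' first
      | exact Feasible.const _
      | exact Feasible.id
      | apply Feasible.elim
      | apply Feasible.comp_wire
  exact h.comp hs

theorem efficient_simulateDown {s : ∀ n, Bits (Γ n) → Bits (A.St n ⊕ Unit)} (hs : Feasible s) :
    Efficient fun n x => simulateDown A n (s n x) := by
  have h : Efficient fun n (x : Bits (A.St n ⊕ Unit)) => simulateDown A n x := by
    unfold simulateDown
    refine .bind (efficient_newKey _) (.bind (efficient_encrypt _ ?_ ?_)
      (.bind (efficient_deliverDown A ?_ ?_) (Feasible.ite (.eq ?_ ?_) ?_ ?_)))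
    all_goals
    repeat' first
      | exact Feasible.const _
      | exact Feasible.id
      | apply Feasible.elim
      | apply Feasible.comp_wire
  exact h.comp hs

theorem efficient_simulate [PolyWires fun n => Fin (auxLen n)] :
    Efficient fun n (x : Bits (Fin (auxLen n) ⊕ (I.HashKey n ⊕ (I.Id n ⊕ I.TokenP n)))) =>
      simulate A n (x ∘ .inl) (x ∘ .inr ∘ .inl) (x ∘ .inr ∘ .inr ∘ .inl)
        (x ∘ .inr ∘ .inr ∘ .inr) := by
  -- The length of the prover's output is bounded by the size of its final circuit.
  have : PolyWires fun n => Fin (outLen n) := A.finish_ppt.polyWires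
  unfold simulate runStart
  refine .bind (A.start_ppt.eval ?_) (.bind (efficient_simulateUp A ?_)
    (.bind (efficient_fetch A ?_ ?_) (.bind (efficient_simulateDown A ?_)
      (.bind (A.finish_ppt.eval ?_) (Feasible.elim ?_ ?_)))))
  all_goals
    repeat' first
      | exact Feasible.const _
      | exact Feasible.id
      | apply Feasible.elim
      | apply Feasible.comp_wire

theorem feasible_idGen {hk : ∀ n, Bits (Γ n) → Bits (I.HashKey n)}
    {Dw : ∀ n, Bits (Γ n) → Bits (I.Asset n)} (hhk : Feasible hk) (hDw : Feasible Dw) :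
    Feasible fun n x => I.ids.idGen n (hk n x) (Dw n x) := by
  have hmeta : Feasible fun n x => I.ids.metadata n (Dw n x) :=
    (I.ids.metadata_ppt.eval hDw).congr fun n x => I.ids.metadata_eval n _
  exact (I.ids.hash.hash_ppt.eval (hhk.elim (.elim (.const _) (hmeta.elim (.const _))))).congr
    fun n x => I.ids.hash.hash_eval n _ _

/-- Ownership data form a record, so they pass through their encoding as a string, and the
continuation decodes them. -/
theorem efficient_generate_bind {α : ℕ → Type} (Do : ∀ n, Bits (I.Asset n))
    {F : ∀ n, Bits (Γ n) → I.Ownership n → PMF (Bits (α n))}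
    (hF : Efficient fun n (x : Bits (Γ n ⊕ I.OwnerWires n)) =>
      F n (x ∘ .inl) (.ofBits (x ∘ .inr))) :
    Efficient fun n x => (I.generate n (Do n)).bind (F n x) := by
  have h : Efficient fun n (_ : Bits (Γ n)) =>
      (I.generate n (Do n)).bind fun g => PMF.pure g.bits := by
    simp only [generate, PMF_bind_eq, PMF_pure_eq, PMF.bind_bind, PMF.pure_bind, Ownership.bits]
    refine .bind (I.ids.hash.keyGen_ppt.eval ?_) (.bind (I.wm.secretGen_ppt.eval ?_)
      (.bind (I.wm.insert_ppt.eval ?_) (.bind (I.ss.share_ppt.eval ?_)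
        (Feasible.elim ?_ (Feasible.elim (feasible_idGen ?_ ?_) ?_)))))
    all_goals
    repeat' first
      | exact Feasible.const _
      | exact Feasible.id
      | apply Feasible.elim
      | apply Feasible.comp_wire
  refine (h.bind (G := fun n x b => F n x (.ofBits b)) hF).congr fun n x => ?_
  simp only [PMF.bind_bind, PMF.pure_bind, Ownership.ofBits_bits]

/-- The verdict is fixed so that its encoding is a hardwired constant; a verdict that depends on a
bit is handled by branching between two such circuits. -/
theorem efficient_conclude {D : ∀ n, Circuit (I.Joint outLen n) Unit} (hD : IsPPT D)
    {b : ∀ n, Bits (Γ n) → Bits (I.OwnerWires n)} {st : ∀ n, Bits (Γ n) → Bits (A.St n)}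
    (hb : Feasible b) (hst : Feasible st) (v : Verdict) :
    Efficient fun n x => conclude A n (D n) (.ofBits (b n x)) v (st n x) := by
  have h : Efficient fun n (x : Bits (I.OwnerWires n ⊕ A.St n)) =>
      conclude A n (D n) (.ofBits (x ∘ .inl)) v (x ∘ .inr) := by
    have : PolyWires fun n => Fin (outLen n) := A.finish_ppt.polyWires
    simp only [conclude, joint, Ownership.ofBits]
    refine .bind (A.finish_ppt.eval ?_) (hD.eval ?_)
    all_goals
    repeat' first
      | exact Feasible.const _
      | exact Feasible.id
      | apply Feasible.elim
      | apply Feasible.comp_wire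
  exact h.comp (hb.elim hst)

theorem efficient_answer {b : ∀ n, Bits (Γ n) → Bits (I.OwnerWires n)}
    {s : ∀ n, Bits (Γ n) → Bits (A.St n ⊕ Unit)} (hb : Feasible b) (hs : Feasible s) :
    Efficient fun n x => answer A n (.ofBits (b n x)) (s n x) := by
  have h : Efficient fun n (x : Bits (I.OwnerWires n ⊕ (A.St n ⊕ Unit))) =>
      answer A n (.ofBits (x ∘ .inl)) (x ∘ .inr) := by
    simp only [answer, Ownership.ofBits]
    refine .bind (efficient_fetch A ?_ ?_)
      (.ite ?_ (efficient_detectWithTokens_bind ?_ ?_ ?_ ?_) ?_)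
    all_goals
    repeat' first
      | exact Feasible.const _
      | exact Feasible.id
      | apply Feasible.elim
      | apply Feasible.comp_wire
  exact h.comp (hb.elim hs)

theorem efficient_upChoose (aux : ∀ n, Bits (Fin (auxLen n))) (Do : ∀ n, Bits (I.Asset n))
    [PolyWires fun n => Fin (auxLen n)] :
    Efficient fun n (_ : Bits Empty) => upChoose A n (aux n) (Do n) := by
  unfold upChoose
  refine efficient_generate_bind Do ?_
  simp only [runStart, Ownership.bits, Ownership.request, Ownership.ofBits]
  refine .bind (A.start_ppt.eval ?_) ?_
  all_goals
    repeat' first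
      | exact Feasible.const _
      | exact Feasible.id
      | apply Feasible.elim
      | apply Feasible.comp_wire

theorem efficient_downChoose (aux : ∀ n, Bits (Fin (auxLen n))) (Do : ∀ n, Bits (I.Asset n))
    [PolyWires fun n => Fin (auxLen n)] :
    Efficient fun n (_ : Bits Empty) => downChoose A n (aux n) (Do n) := by
  unfold downChoose
  refine efficient_generate_bind Do ?_
  unfold runStart
  refine .bind (A.start_ppt.eval ?_) (.bind (efficient_simulateUp A ?_)
    (.bind (efficient_answer A (b := fun n x => ((x ∘ Sum.inl) ∘ Sum.inl) ∘ Sum.inr) ?_ ?_) ?_))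
  all_goals
    try simp only [Ownership.bits, Ownership.ofBits]
    repeat' first
      | exact Feasible.const _
      | exact Feasible.id
      | apply Feasible.elim
      | apply Feasible.comp_wire

theorem efficient_upTamper : Efficient fun n (x : Bits (AttackState A n ⊕ I.CtUp n)) =>
    upTamper A n (x ∘ .inl) (x ∘ .inr) := by
  unfold upTamper
  refine .bind (efficient_deliverUp A ?_ ?_) ?_
  all_goals
    repeat' first
      | exact Feasible.const _
      | exact Feasible.id
      | apply Feasible.elim
      | apply Feasible.comp_wire

theorem efficient_downTamper : Efficient fun n (x : Bits (AttackState A n ⊕ I.CtDown n)) =>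
    downTamper A n (x ∘ .inl) (x ∘ .inr) := by
  unfold downTamper
  refine .bind (efficient_deliverDown A ?_ ?_) ?_
  all_goals
    repeat' first
      | exact Feasible.const _
      | exact Feasible.id
      | apply Feasible.elim
      | apply Feasible.comp_wire

theorem efficient_downGuess {D : ∀ n, Circuit (I.Joint outLen n) Unit} (hD : IsPPT D) :
    Efficient fun n (x : Bits (AttackState A n ⊕ (Unit ⊕ Unit))) =>
      downGuess A n (D n) (x ∘ .inl) (toOption (x ∘ .inr)) := by
  simp only [downGuess, toOption_elim, Verdict.ofRes, apply_ite (conclude A _ _ _), ite_apply]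
  refine .ite ?_ (.ite ?_ (.ite ?_ (efficient_conclude A hD ?_ ?_ _)
    (efficient_conclude A hD ?_ ?_ _)) (efficient_conclude A hD ?_ ?_ _))
    (efficient_conclude A hD ?_ ?_ _)
  all_goals
    repeat' first
      | exact Feasible.const _
      | exact Feasible.id
      | apply Feasible.elim
      | apply Feasible.comp_wire

theorem efficient_upGuess {D : ∀ n, Circuit (I.Joint outLen n) Unit} (hD : IsPPT D) :
    Efficient fun n (x : Bits (AttackState A n ⊕ (Unit ⊕ (I.Id n ⊕ (I.Asset n ⊕ I.TokenH n))))) =>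
      upGuess A n (D n) (x ∘ .inl) (toOption (x ∘ .inr)) := by
  -- Flattens the enclave's program into nested binds and tests of single wires, which the
  -- combinators below follow step by step.
  simp only [upGuess, toOption_elim, realEnclave_bind, realRespond_bind, decrypt_bind,
    Verdict.ofRes, apply_ite (conclude A _ _ _), ite_apply]
  refine .ite ?_ (.ite ?_ (.bind (efficient_newKey _) (.bind (A.onFetch_ppt.eval ?_)
    (.ite ?_ (efficient_detectWithTokens_bind ?_ ?_ ?_ (.bind (efficient_encrypt _ ?_ ?_)
      (.bind (A.onResponse_ppt.eval ?_) (.ite ?_ (.bind (I.tee.down.dec_ppt.eval ?_)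
        (.ite ?_ (.ite ?_ (efficient_conclude A hD ?_ ?_ _) (efficient_conclude A hD ?_ ?_ _))
          (efficient_conclude A hD ?_ ?_ _))) (efficient_conclude A hD ?_ ?_ _)))))
      (efficient_conclude A hD ?_ ?_ _)))) (efficient_conclude A hD ?_ ?_ _))
    (efficient_conclude A hD ?_ ?_ _)
  all_goals
    repeat' first
      | exact Feasible.const _
      | exact Feasible.id
      | apply Feasible.elim
      | apply Feasible.comp_wire

end

/-! ### Combination of the two game hops -/

theorem secureAgainstProver_of_secure_tee (I : Instance) (htee : I.tee.Secure) :
    I.SecureAgainstProver := by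
  intro auxLen outLen haux A
  have : PolyWires fun n => Fin (auxLen n) := haux.polyWires
  -- The simulator reads the auxiliary input from its wires, so it is fixed before `aux` and `Do`;
  -- the attackers used below may depend on both.
  obtain ⟨run, run_ppt, run_eval⟩ := efficient_simulate A
  refine ⟨⟨fun _ => 1, run, run_ppt⟩, fun aux Do D hD => ?_⟩
  simp only [ideal_bind A _ _ run run_ppt (run_eval _), real_bind]
  refine Negligible.of_abs_sub
    (b := fun n => prOne (I.tee.up.idealExperiment (St := AttackState A) n
      (upChoose A n (aux n) (Do n)) (upTamper A n) (upGuess A n (D n))))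
    (htee.1.negligible_experiment (efficient_upChoose A aux Do) (efficient_upTamper A)
      (efficient_upGuess A hD)) ?_
  simp only [idealExperiment_up]
  exact htee.2.negligible_experiment (efficient_downChoose A aux Do) (efficient_downTamper A)
    (efficient_downGuess A hD)

end Instance
end Puppy

theorem theorem2 (I : Puppy.Instance)
    (hss : I.ss.Secure) (hwm : I.wm.Secure) (htee : I.tee.Secure)
    (hhash : I.ids.hash.CollisionResistant) :
    I.SecureAgainstProver :=
  I.secureAgainstProver_of_secure_tee htee
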